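/- Let $E$ be a finite-dimensional real inner product space with its induced norm (for instance $\mathbb{R}^n$ with the Euclidean norm, or $\mathbb{R}^{n\times m}$ with the Frobenius norm). Call a set $C\subseteq E$ convex polyhedral if it is the solution set of finitely many linear inequalities, $C=\{z\in E:\langle a_i,z\rangle\le b_i,\ i=1,\dots,k\}$, and for a nonempty closed convex set $C\subseteq E$ let $P_C(u)$ denote the unique point of $C$ nearest to $u$. Let $C_1,C_2\subseteq E$ be convex polyhedral sets with $C_1\cap C_2\neq\emptyset$. Then there is a constant $M>0$, depending only on $C_1$ and $C_2$, such that for all $x,y\in E$ $$\left\|P_{C_1}(x)+P_{C_2}(y)-2P_{C_1\cap C_2}\!\left(\frac{x+y}{2}\right)\right\|\le M\left\|P_{C_1}(x)-P_{C_2}(y)\right\|.$$ In particular this holds for all $x\in C_1$ and $y\in C_2$. -/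

import Mathlib

/-- A convex polyhedral set: the solution set of finitely many (possibly zero) linear inequalities
`⟪a i, z⟫ ≤ b i`. It may be unbounded. -/
def IsConvexPolyhedral {E : Type*} [NormedAddCommGroup E] [InnerProductSpace ℝ E]
    (C : Set E) : Prop :=
  ∃ (k : ℕ) (a : Fin k → E) (b : Fin k → ℝ), C = {z | ∀ i, inner ℝ (a i) z ≤ b i}

/-- `p` is a nearest point of `K` to `u`. -/
def IsNearestPoint {E : Type*} [NormedAddCommGroup E] (K : Set E) (u p : E) : Prop :=
  p ∈ K ∧ ∀ w ∈ K, ‖u - p‖ ≤ ‖u - w‖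

open Classical in
/-- The metric projection of `u` onto `K`: the nearest point of `K` to `u`. For a nonempty
convex polyhedral set `K` in a finite-dimensional space it exists and is unique (proved below);
the value `u` in the other branch is then never used. -/
noncomputable def metricProj {E : Type*} [NormedAddCommGroup E] (K : Set E) (u : E) : E :=
  if h : ∃ p, IsNearestPoint K u p then h.choose else u

theorem IsConvexPolyhedral.isClosed {E : Type*} [NormedAddCommGroup E] [InnerProductSpace ℝ E]
    {C : Set E} (hC : IsConvexPolyhedral C) : IsClosed C := by
  obtain ⟨k, a, b, rfl⟩ := hC
  rw [Set.setOf_forall]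
  exact isClosed_iInter fun i => isClosed_le (by fun_prop) continuous_const

theorem IsConvexPolyhedral.convex {E : Type*} [NormedAddCommGroup E] [InnerProductSpace ℝ E]
    {C : Set E} (hC : IsConvexPolyhedral C) : Convex ℝ C := by
  obtain ⟨k, a, b, rfl⟩ := hC
  rw [Set.setOf_forall]
  exact convex_iInter fun i => convex_halfSpace_le (innerSL ℝ (a i)).isLinear (b i)

theorem IsConvexPolyhedral.inter {E : Type*} [NormedAddCommGroup E] [InnerProductSpace ℝ E]
    {C D : Set E} (hC : IsConvexPolyhedral C) (hD : IsConvexPolyhedral D) :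
    IsConvexPolyhedral (C ∩ D) := by
  obtain ⟨k, a, b, rfl⟩ := hC
  obtain ⟨l, c, d, rfl⟩ := hD
  refine ⟨k + l, Fin.append a c, Fin.append b d, ?_⟩
  ext z
  simp [Fin.forall_fin_add]

/-- The projection onto a nonempty closed set is a nearest point of that set. -/
theorem isNearestPoint_metricProj {E : Type*} [NormedAddCommGroup E] [InnerProductSpace ℝ E]
    [FiniteDimensional ℝ E] {K : Set E} (hne : K.Nonempty) (hcl : IsClosed K) (u : E) :
    IsNearestPoint K u (metricProj K u) := by
  have h : ∃ p, IsNearestPoint K u p := by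
    haveI : ProperSpace E := FiniteDimensional.proper ℝ E
    obtain ⟨p, hp, hd⟩ := hcl.exists_infDist_eq_dist hne u
    refine ⟨p, hp, fun w hw => ?_⟩
    rw [← dist_eq_norm, ← dist_eq_norm, ← hd]
    exact Metric.infDist_le_dist_of_mem hw
  unfold metricProj
  rw [dif_pos h]
  exact h.choose_spec

/-- Nearest points of a convex set are unique. -/
theorem IsNearestPoint.eq {E : Type*} [NormedAddCommGroup E] [InnerProductSpace ℝ E]
    {K : Set E} (hK : Convex ℝ K) {u p q : E} (hp : IsNearestPoint K u p)
    (hq : IsNearestPoint K u q) : p = q := by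
  have hm : (1 / 2 : ℝ) • p + (1 / 2 : ℝ) • q ∈ K :=
    hK hp.1 hq.1 (by norm_num) (by norm_num) (by norm_num)
  have h1 := hp.2 _ hq.1
  have h2 := hq.2 _ hp.1
  have h3 := hp.2 _ hm
  have h4 : u - ((1 / 2 : ℝ) • p + (1 / 2 : ℝ) • q)
      = (1 / 2 : ℝ) • ((u - p) + (u - q)) := by module
  rw [h4, norm_smul, Real.norm_of_nonneg (by norm_num)] at h3
  have h5 := parallelogram_law_with_norm ℝ (u - p) (u - q)
  have h6 : u - p - (u - q) = q - p := by abel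
  rw [h6] at h5
  have h7 : ‖q - p‖ = 0 := by
    have := norm_nonneg (q - p)
    have := norm_nonneg (u - p)
    nlinarith
  exact (sub_eq_zero.1 (norm_eq_zero.1 h7)).symm

/-! Write p, q for the projections of x, y. Averaging the residuals x - p and y - q and adding them
to p gives a point m whose projection onto C₁ ∩ (C₂ + (p - q)) is p. This set has the same normals
as C₁ ∩ C₂, with right-hand sides moved by O(‖p - q‖), and m is (p - q)/2 away from (x + y)/2. So it
is enough that projections are nonexpansive and that, for fixed normals, the projection is Lipschitz
in the right-hand side, uniformly in m (`exists_lipschitz_proj_polyhedron`). For the latter, move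
the right-hand side along a segment. While one set of active constraints certifies the projection,
its displacement lies in the span of their normals, hence is controlled by the change in the
right-hand side. Finitely many such sets cover the segment, and `norm_sub_le_of_finset_cover` glues
the estimates. -/

open Set

section

variable {E : Type*} [NormedAddCommGroup E] [InnerProductSpace ℝ E]

/-- The variational characterization of the projection `w` of `m` onto `K`. -/
def IsVariationalProj (K : Set E) (m w : E) : Prop :=
  w ∈ K ∧ ∀ c ∈ K, inner ℝ (m - w) (c - w) ≤ 0

theorem IsNearestPoint.isVariationalProj {K : Set E} (hK : Convex ℝ K) {m w : E}
    (h : IsNearestPoint K m w) : IsVariationalProj K m w := by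
  refine ⟨h.1, (norm_eq_iInf_iff_real_inner_le_zero hK h.1).1 (le_antisymm ?_ ?_)⟩
  · have : Nonempty K := ⟨⟨w, h.1⟩⟩
    exact le_ciInf fun c => h.2 c c.2
  · exact ciInf_le ⟨0, by rintro _ ⟨c, rfl⟩; exact norm_nonneg _⟩ (⟨w, h.1⟩ : K)

/-- Projections onto a fixed set are nonexpansive. -/
theorem IsVariationalProj.norm_sub_le {K : Set E} {m m' w w' : E}
    (h : IsVariationalProj K m w) (h' : IsVariationalProj K m' w') :
    ‖w - w'‖ ≤ ‖m - m'‖ := by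
  have h1 := h.2 _ h'.1
  have h2 := h'.2 _ h.1
  have h3 : inner ℝ (w - w') (w - w') ≤ inner ℝ (m - m') (w - w') := by
    have e : inner ℝ (m - m') (w - w') - inner ℝ (w - w') (w - w')
        = -(inner ℝ (m - w) (w' - w) + inner ℝ (m' - w') (w - w')) := by
      simp only [inner_sub_left, inner_sub_right]; ring
    linarith
  have h4 := real_inner_le_norm (m - m') (w - w')
  rw [real_inner_self_eq_norm_sq] at h3
  by_contra! hlt
  have := norm_nonneg (m - m')
  nlinarith

theorem IsVariationalProj.eq {K : Set E} {m w w' : E}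
    (h : IsVariationalProj K m w) (h' : IsVariationalProj K m w') : w = w' := by
  simpa [sub_eq_zero] using h.norm_sub_le h'

/-- A function that is Lipschitz on each member of a finite compact cover of an interval is
Lipschitz between the endpoints. -/
theorem norm_sub_le_of_finset_cover {ι F : Type*} [NormedAddCommGroup F] [DecidableEq ι] {f : ℝ → F}
    {S : ι → Set ℝ} {L : ℝ} (hS : ∀ i, IsCompact (S i))
    (hL : ∀ i, ∀ s ∈ S i, ∀ t ∈ S i, ‖f s - f t‖ ≤ L * |s - t|) {b : ℝ} (J : Finset ι) :
    ∀ a ≤ b, (∀ t ∈ Icc a b, ∃ i ∈ J, t ∈ S i) → ‖f a - f b‖ ≤ L * (b - a) := by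
  induction J using Finset.strongInduction with
  | H J ih =>
    intro a hab hcov
    obtain ⟨i, hiJ, hai⟩ := hcov a ⟨le_rfl, hab⟩
    -- Jump to the last time c in `S i`: after c this set is never needed, and c itself is covered
    -- by the others because their union is closed.
    obtain ⟨c, ⟨hci, hac, hcb⟩, hc⟩ := ((hS i).inter_right isClosed_Icc).exists_isGreatest
      ⟨a, hai, le_rfl, hab⟩
    have h1 := hL i a hai c hci
    rw [abs_sub_comm, abs_of_nonneg (sub_nonneg.2 hac)] at h1
    rcases hcb.eq_or_lt with rfl | hlt
    · exact h1
    have hcl : IsClosed (⋃ j ∈ J.erase i, S j) :=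
      (J.erase i).finite_toSet.isClosed_biUnion fun j _ => (hS j).isClosed
    have hsub : Ioc c b ⊆ ⋃ j ∈ J.erase i, S j := by
      intro t ht
      obtain ⟨j, hj, htj⟩ := hcov t ⟨hac.trans ht.1.le, ht.2⟩
      have hji : j ≠ i := by
        rintro rfl
        exact absurd (hc ⟨htj, hac.trans ht.1.le, ht.2⟩) (not_le.2 ht.1)
      exact mem_biUnion (Finset.mem_coe.2 (Finset.mem_erase.2 ⟨hji, hj⟩)) htj
    have hsub' : Icc c b ⊆ ⋃ j ∈ J.erase i, S j := by
      rw [← closure_Ioc hlt.ne]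
      exact hcl.closure_subset_iff.2 hsub
    have h2 := ih _ (Finset.erase_ssubset hiJ) c hlt.le fun t ht => by
      simpa only [mem_iUnion, exists_prop] using hsub' ht
    calc ‖f a - f b‖ ≤ ‖f a - f c‖ + ‖f c - f b‖ := norm_sub_le_norm_sub_add_norm_sub _ _ _
      _ ≤ L * (c - a) + L * (b - c) := add_le_add h1 h2
      _ = L * (b - a) := by ring

/-- The solution set of the linear inequalities `⟪a i, z⟫ ≤ b i`. -/
def polyhedron {ι : Type*} (a : ι → E) (b : ι → ℝ) : Set E := {z | ∀ i, inner ℝ (a i) z ≤ b i}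

theorem isClosed_polyhedron {ι : Type*} (a : ι → E) (b : ι → ℝ) : IsClosed (polyhedron a b) := by
  rw [polyhedron, Set.ofPred_forall]
  exact isClosed_iInter fun i => isClosed_le (by fun_prop) continuous_const

theorem convex_polyhedron {ι : Type*} (a : ι → E) (b : ι → ℝ) : Convex ℝ (polyhedron a b) := by
  rw [polyhedron, Set.ofPred_forall]
  exact convex_iInter fun i => convex_halfSpace_le (innerSL ℝ (a i)).isLinear (b i)

/-- The cone generated by the `a i`, `i ∈ I`, written as a bipolar. -/
def bipolarCone {ι : Type*} (a : ι → E) (I : Finset ι) : Set E :=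
  {n | ∀ d, (∀ i ∈ I, inner ℝ (a i) d ≤ 0) → inner ℝ n d ≤ 0}

theorem isClosed_bipolarCone {ι : Type*} (a : ι → E) (I : Finset ι) :
    IsClosed (bipolarCone a I) := by
  simp only [bipolarCone, Set.ofPred_forall]
  exact isClosed_iInter fun d => isClosed_iInter fun _ =>
    isClosed_le (by fun_prop) continuous_const

theorem inner_eq_zero_of_mem_bipolarCone {ι : Type*} {a : ι → E} {I : Finset ι} {n d : E}
    (hn : n ∈ bipolarCone a I) (hd : ∀ i ∈ I, inner ℝ (a i) d = 0) : inner ℝ n d = 0 := by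
  refine le_antisymm (hn d fun i hi => (hd i hi).le) ?_
  have := hn (-d) fun i hi => by rw [inner_neg_right, hd i hi, neg_zero]
  rwa [inner_neg_right, neg_nonpos] at this

/-- At the projection onto a polyhedron, the residual lies in the cone of the active constraints. -/
theorem IsVariationalProj.sub_mem_bipolarCone {ι : Type*} [Fintype ι] {a : ι → E} {b : ι → ℝ}
    {m w : E} (h : IsVariationalProj (polyhedron a b) m w) {I : Finset ι}
    (hI : ∀ i, inner ℝ (a i) w = b i → i ∈ I) : m - w ∈ bipolarCone a I := by
  intro d hd
  -- A short step along d stays feasible: constraints in I do not increase, the others have slack.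
  have hev : ∀ᶠ ε : ℝ in nhdsWithin 0 (Ioi 0), ∀ i, inner ℝ (a i) (w + ε • d) ≤ b i := by
    rw [Filter.eventually_all]
    intro i
    by_cases hi : i ∈ I
    · filter_upwards [self_mem_nhdsWithin] with ε hε
      rw [inner_add_right, inner_smul_right]
      have := mul_nonpos_of_nonneg_of_nonpos (le_of_lt hε) (hd i hi)
      linarith [h.1 i]
    · have hlt : inner ℝ (a i) w < b i := lt_of_le_of_ne (h.1 i) fun he => hi (hI i he)
      have hc : Continuous fun ε : ℝ => inner ℝ (a i) (w + ε • d) := by fun_prop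
      have := hc.continuousAt (x := 0)
      refine nhdsWithin_le_nhds ?_
      filter_upwards [this.eventually_lt_const (by simpa using hlt)] with ε hε using hε.le
  obtain ⟨ε, hε, hε0⟩ := (hev.and self_mem_nhdsWithin).exists
  have h1 := h.2 _ hε
  rw [add_sub_cancel_left, inner_smul_right] at h1
  exact nonpos_of_mul_nonpos_right h1 hε0

theorem isVariationalProj_of_sub_mem_bipolarCone {ι : Type*} {a : ι → E} {b : ι → ℝ}
    {m w : E} {I : Finset ι} (hw : w ∈ polyhedron a b) (hI : ∀ i ∈ I, inner ℝ (a i) w = b i)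
    (hn : m - w ∈ bipolarCone a I) : IsVariationalProj (polyhedron a b) m w :=
  ⟨hw, fun c hc => hn _ fun i hi => by
    rw [inner_sub_right, hI i hi]; exact sub_nonpos.2 (hc i)⟩

variable [FiniteDimensional ℝ E]

/-- A vector orthogonal to everything that the `a i`, `i ∈ I`, annihilate is controlled by its
inner products with these `a i`. -/
theorem exists_norm_le_of_inner_le {ι : Type*} (a : ι → E) (I : Finset ι) :
    ∃ L : ℝ, 0 ≤ L ∧ ∀ (d : E) (r : ℝ), 0 ≤ r →
      (∀ e, (∀ i ∈ I, inner ℝ (a i) e = 0) → inner ℝ d e = 0) →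
      (∀ i ∈ I, |inner ℝ (a i) d| ≤ r) → ‖d‖ ≤ L * r := by
  -- W is the span of the `a i`, as a double annihilator; pairing with them is injective on W, hence
  -- bounded below.
  let W : Submodule ℝ E :=
    { carrier := {d | ∀ e, (∀ i ∈ I, inner ℝ (a i) e = 0) → inner ℝ d e = 0}
      zero_mem' := fun e _ => inner_zero_left e
      add_mem' := fun {x y} hx hy e he => by rw [inner_add_left, hx e he, hy e he, add_zero]
      smul_mem' := fun c x hx e he => by rw [inner_smul_left, hx e he, mul_zero] }
  let φ : W →ₗ[ℝ] (I → ℝ) := LinearMap.pi fun i => (innerₗ E (a i)).comp W.subtype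
  have hφ : LinearMap.ker φ = ⊥ := by
    refine LinearMap.ker_eq_bot'.2 fun d hd => ?_
    have h : inner ℝ (d : E) (d : E) = 0 := d.2 _ fun i hi => congrFun hd ⟨i, hi⟩
    exact Subtype.ext (inner_self_eq_zero.1 h)
  obtain ⟨K, -, hK⟩ := φ.exists_antilipschitzWith hφ
  refine ⟨K, K.2, fun d r hr hd hdr => ?_⟩
  have h1 := hK.le_mul_dist (⟨d, hd⟩ : W) 0
  rw [map_zero, dist_zero_right, dist_zero_right] at h1
  refine h1.trans (mul_le_mul_of_nonneg_left ?_ K.2)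
  exact (pi_norm_le_iff_of_nonneg hr).2 fun i => hdr i i.2

theorem isVariationalProj_metricProj {K : Set E} (hne : K.Nonempty) (hcl : IsClosed K)
    (hK : Convex ℝ K) (m : E) : IsVariationalProj K m (metricProj K m) :=
  (isNearestPoint_metricProj hne hcl m).isVariationalProj hK

/-- The projection onto a polyhedron is Lipschitz in the right-hand side of the inequalities,
uniformly in the projected point. -/
theorem exists_lipschitz_proj_polyhedron {ι : Type*} [Fintype ι] (a : ι → E) :
    ∃ L : ℝ, 0 ≤ L ∧ ∀ (b b' : ι → ℝ) (m w w' : E) (r : ℝ), 0 ≤ r →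
      (∀ i, |b' i - b i| ≤ r) → IsVariationalProj (polyhedron a b) m w →
      IsVariationalProj (polyhedron a b') m w' → ‖w - w'‖ ≤ L * r := by
  classical
  choose L hL0 hL using exists_norm_le_of_inner_le a
  have hLsum : ∀ I, L I ≤ ∑ J, L J := fun I =>
    Finset.single_le_sum (fun J _ => hL0 J) (Finset.mem_univ I)
  refine ⟨∑ J, L J, Finset.sum_nonneg fun J _ => hL0 J, fun b b' m w w' r hr hbr hw hw' => ?_⟩
  let β : ℝ → ι → ℝ := fun t i => b i + t * (b' i - b i)
  let f : ℝ → E := fun t => metricProj (polyhedron a (β t)) m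
  have hf : ∀ t ∈ Icc (0 : ℝ) 1, IsVariationalProj (polyhedron a (β t)) m (f t) := by
    intro t ht
    refine isVariationalProj_metricProj ⟨(1 - t) • w + t • w', fun i => ?_⟩
      (isClosed_polyhedron _ _) (convex_polyhedron _ _) m
    rw [inner_add_right, inner_smul_right, inner_smul_right]
    have h1 := mul_le_mul_of_nonneg_left (hw.1 i) (sub_nonneg.2 ht.2)
    have h2 := mul_le_mul_of_nonneg_left (hw'.1 i) ht.1
    change _ ≤ b i + t * (b' i - b i)
    linarith
  -- I need not contain every active constraint; asking only for equalities and cone membership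
  -- keeps these conditions closed.
  let S : Finset ι → Set ℝ := fun I =>
    {t | t ∈ Icc (0 : ℝ) 1 ∧ (∀ i ∈ I, inner ℝ (a i) (f t) = β t i) ∧ m - f t ∈ bipolarCone a I}
  have hlip : ∀ I, ∀ s ∈ S I, ∀ t ∈ S I, ‖f s - f t‖ ≤ (∑ J, L J) * r * |s - t| := by
    intro I s hs t ht
    have h1 : ‖f s - f t‖ ≤ L I * (r * |s - t|) := by
      refine hL I _ _ (by positivity) (fun e he => ?_) fun i hi => ?_
      · have e1 := inner_eq_zero_of_mem_bipolarCone hs.2.2 he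
        have e2 := inner_eq_zero_of_mem_bipolarCone ht.2.2 he
        rw [inner_sub_left] at e1 e2 ⊢
        linarith
      · rw [inner_sub_right, hs.2.1 i hi, ht.2.1 i hi]
        have : β s i - β t i = (b' i - b i) * (s - t) := by simp only [β]; ring
        rw [this, abs_mul]
        exact mul_le_mul_of_nonneg_right (hbr i) (abs_nonneg _)
    rw [mul_assoc]
    exact h1.trans (mul_le_mul_of_nonneg_right (hLsum I) (by positivity))
  have hcpt : ∀ I, IsCompact (S I) := by
    intro I
    rcases (S I).eq_empty_or_nonempty with he | ⟨t₀, ht₀⟩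
    · rw [he]; exact isCompact_empty
    have : ProperSpace E := FiniteDimensional.proper ℝ E
    let Q : Set (ℝ × E) := {p | p.2 ∈ polyhedron a (β p.1) ∧
      (∀ i ∈ I, inner ℝ (a i) p.2 = β p.1 i) ∧ m - p.2 ∈ bipolarCone a I}
    have hβ : ∀ i, Continuous fun p : ℝ × E => β p.1 i := fun i => by
      simp only [β]; fun_prop
    have hQ : IsClosed Q := by
      have h : Q = (⋂ i, {p : ℝ × E | inner ℝ (a i) p.2 ≤ β p.1 i}) ∩
          ((⋂ i ∈ I, {p : ℝ × E | inner ℝ (a i) p.2 = β p.1 i}) ∩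
            (fun p : ℝ × E => m - p.2) ⁻¹' bipolarCone a I) := by
        ext p
        simp [Q, polyhedron]
      rw [h]
      refine (isClosed_iInter fun i => isClosed_le (by fun_prop) (hβ i)).inter
        (IsClosed.inter ?_ ((isClosed_bipolarCone a I).preimage (by fun_prop)))
      exact isClosed_iInter fun i => isClosed_iInter fun _ => isClosed_eq (by fun_prop) (hβ i)
    -- Compactness without knowing that f is continuous: `hlip` confines f to a ball, and the closed
    -- conditions in Q determine f.
    have hS : S I = Prod.fst '' ((Icc (0 : ℝ) 1 ×ˢ
        Metric.closedBall (f t₀) ((∑ J, L J) * r * 1)) ∩ Q) := by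
      ext t
      constructor
      · intro ht
        refine ⟨(t, f t), ⟨⟨ht.1, ?_⟩, (hf t ht.1).1, ht.2⟩, rfl⟩
        rw [mem_closedBall_iff_norm]
        refine (hlip I t ht t₀ ht₀).trans (mul_le_mul_of_nonneg_left ?_ ?_)
        · exact abs_le.2 ⟨by linarith [ht.1.1, ht₀.1.2], by linarith [ht.1.2, ht₀.1.1]⟩
        · exact mul_nonneg (Finset.sum_nonneg fun J _ => hL0 J) hr
      · rintro ⟨⟨s, z⟩, ⟨⟨hs, -⟩, hz, hz1, hz2⟩, rfl⟩
        have : z = f s :=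
          (isVariationalProj_of_sub_mem_bipolarCone hz hz1 hz2).eq (hf s hs)
        subst this
        exact ⟨hs, hz1, hz2⟩
    rw [hS]
    exact ((isCompact_Icc.prod (isCompact_closedBall _ _)).inter_right hQ).image continuous_fst
  have hcov : ∀ t ∈ Icc (0 : ℝ) 1, ∃ I ∈ (Finset.univ : Finset (Finset ι)), t ∈ S I := by
    intro t ht
    refine ⟨Finset.univ.filter fun i => inner ℝ (a i) (f t) = β t i, Finset.mem_univ _, ht,
      fun i hi => (Finset.mem_filter.1 hi).2, ?_⟩
    exact (hf t ht).sub_mem_bipolarCone fun i hi => Finset.mem_filter.2 ⟨Finset.mem_univ _, hi⟩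
  have hfin := norm_sub_le_of_finset_cover hcpt hlip Finset.univ 0 zero_le_one hcov
  have e0 : β 0 = b := by ext i; simp [β]
  have e1 : β 1 = b' := by ext i; simp [β]
  have h0 := hf 0 (by simp)
  have h1 := hf 1 (by simp)
  rw [e0] at h0
  rw [e1] at h1
  rw [hw.eq h0, hw'.eq h1]
  simpa using hfin

end

theorem mainTheorem7 {E : Type*} [NormedAddCommGroup E] [InnerProductSpace ℝ E]
    [FiniteDimensional ℝ E] (C₁ C₂ : Set E)
    (hC₁ : IsConvexPolyhedral C₁) (hC₂ : IsConvexPolyhedral C₂) (hne : (C₁ ∩ C₂).Nonempty) :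
    ∃ M : ℝ, 0 < M ∧ ∀ x y : E,
      ‖metricProj C₁ x + metricProj C₂ y
          - (2 : ℝ) • metricProj (C₁ ∩ C₂) ((1 / 2 : ℝ) • (x + y))‖
        ≤ M * ‖metricProj C₁ x - metricProj C₂ y‖ := by
  have hp : ∀ x, IsVariationalProj C₁ x (metricProj C₁ x) :=
    isVariationalProj_metricProj hne.left hC₁.isClosed hC₁.convex
  have hq : ∀ y, IsVariationalProj C₂ y (metricProj C₂ y) :=
    isVariationalProj_metricProj hne.right hC₂.isClosed hC₂.convex
  have hw : ∀ m, IsVariationalProj (C₁ ∩ C₂) m (metricProj (C₁ ∩ C₂) m) :=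
    isVariationalProj_metricProj hne (hC₁.inter hC₂).isClosed (hC₁.inter hC₂).convex
  obtain ⟨k, a, b, h₁⟩ := hC₁
  obtain ⟨l, c, d, h₂⟩ := hC₂
  have h₁₂ : C₁ ∩ C₂ = polyhedron (Sum.elim a c) (Sum.elim b d) := by
    subst h₁ h₂
    ext z
    simp [polyhedron]
  obtain ⟨L, hL0, hL⟩ := exists_lipschitz_proj_polyhedron (Sum.elim a c)
  set A : ℝ := ∑ i, ‖c i‖ with hA
  have hA0 : 0 ≤ A := Finset.sum_nonneg fun i _ => norm_nonneg _
  -- 2LA pays for the shift of C₂, 1 for moving m to (x + y)/2, and 1 for replacing 2p by p + q.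
  refine ⟨2 * (L * A) + 2, by positivity, fun x y => ?_⟩
  have hp := hp x
  have hq := hq y
  generalize metricProj C₁ x = p at hp ⊢
  generalize metricProj C₂ y = q at hq ⊢
  -- `p` is the projection of `m` onto the intersection of `C₁` with the translate of `C₂` by `p - q`
  set m : E := p + (1 / 2 : ℝ) • ((x - p) + (y - q)) with hm
  have hshift : IsVariationalProj
      (polyhedron (Sum.elim a c) (Sum.elim b fun i => d i + inner ℝ (c i) (p - q))) m p := by
    have hmem : ∀ z, z ∈ polyhedron (Sum.elim a c)
        (Sum.elim b fun i => d i + inner ℝ (c i) (p - q)) ↔ z ∈ C₁ ∧ z - (p - q) ∈ C₂ := by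
      intro z
      subst h₁ h₂
      simp only [polyhedron, mem_ofPred_eq, Sum.forall, Sum.elim_inl, Sum.elim_inr]
      simp only [inner_sub_right (𝕜 := ℝ) _ z, sub_le_iff_le_add]
    refine ⟨(hmem p).2 ⟨hp.1, by simpa using hq.1⟩, fun z hz => ?_⟩
    obtain ⟨hz1, hz2⟩ := (hmem z).1 hz
    have i1 := hp.2 z hz1
    have i2 := hq.2 _ hz2
    rw [show z - (p - q) - q = z - p by abel] at i2
    rw [hm, add_sub_cancel_left, inner_smul_left, inner_add_left]
    simp only [conj_trivial]
    linarith
  have hm' := hw m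
  rw [h₁₂] at hm'
  have hkey := hL _ _ m _ _ (A * ‖p - q‖) (by positivity) ?_ hm' hshift
  · rw [← h₁₂] at hkey
    have hne := (hw m).norm_sub_le (hw ((1 / 2 : ℝ) • (x + y)))
    have hd : m - (1 / 2 : ℝ) • (x + y) = (1 / 2 : ℝ) • (p - q) := by rw [hm]; module
    rw [hd, norm_smul, Real.norm_of_nonneg (by norm_num)] at hne
    generalize metricProj (C₁ ∩ C₂) m = v at hkey hne
    generalize metricProj (C₁ ∩ C₂) ((1 / 2 : ℝ) • (x + y)) = w at hne ⊢
    have e : p + q - (2 : ℝ) • w = (2 : ℝ) • (v - w) - (2 : ℝ) • (v - p) - (p - q) := by module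
    rw [e]
    calc ‖(2 : ℝ) • (v - w) - (2 : ℝ) • (v - p) - (p - q)‖
        ≤ ‖(2 : ℝ) • (v - w)‖ + ‖(2 : ℝ) • (v - p)‖ + ‖p - q‖ :=
          (norm_sub_le _ _).trans (add_le_add_left (norm_sub_le _ _) _)
      _ = 2 * ‖v - w‖ + 2 * ‖v - p‖ + ‖p - q‖ := by
          rw [norm_smul, norm_smul, Real.norm_of_nonneg (by norm_num)]
      _ ≤ (2 * (L * A) + 2) * ‖p - q‖ := by linarith
  · rintro (i | i)
    · simpa using by positivity
    · simp only [Sum.elim_inr, add_sub_cancel_left]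
      refine (abs_real_inner_le_norm _ _).trans (mul_le_mul_of_nonneg_right ?_ (norm_nonneg _))
      exact Finset.single_le_sum (f := fun i => ‖c i‖) (fun j _ => norm_nonneg _)
        (Finset.mem_univ i)
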